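/- Let $\mathcal W$ be a smooth compact manifold (Hausdorff, finite-dimensional, without boundary), and let $V_1,\dots,V_p$ be smooth vector fields on $\mathcal W$ (the velocity fields attached to the $p$ covariate channels). For a smooth vector field $V$ let $\exp(V):\mathcal W\to\mathcal W$ be the time-one map of its flow, i.e. $\exp(V)(w)=\gamma(1)$ where $\gamma:\mathbb R\to\mathcal W$ is the integral curve with $\gamma'(t)=V(\gamma(t))$, $\gamma(0)=w$; thus $\exp(sV_m)$ is the deformation of $\mathcal W$ induced by shifting channel $m$ alone by $s\in\mathbb R$. Then the following are equivalent: 1. (Path independence) for all $m,n\in\{1,\dots,p\}$ with $m\ne n$ and all $s,t\in\mathbb R$, $$\exp(sV_m)\circ\exp(tV_n)=\exp(tV_n)\circ\exp(sV_m);$$ 2. (Commuting velocity fields) for all $m,n\in\{1,\dots,p\}$ with $m\ne n$, the Lie bracket vanishes: $[V_m,V_n]=0$ on $\mathcal W$. -/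

import Mathlib

open scoped Manifold ContDiff

namespace CovariateDeformation

variable {E : Type*} [NormedAddCommGroup E] [NormedSpace ℝ E]
  {H : Type*} [TopologicalSpace H] (I : ModelWithCorners ℝ E H)
  {W : Type*} [TopologicalSpace W] [ChartedSpace H W]

/-- A velocity field on `W`: a (globally defined) `C^∞` vector field, i.e. a `C^∞` section of the
tangent bundle. -/
def IsVelocityField [IsManifold I ∞ W] (V : (w : W) → TangentSpace I w) : Prop :=
  ContMDiff I I.tangent ∞ (fun w => (⟨w, V w⟩ : TangentBundle I W))

open Classical in
/-- The exponential map of a vector field: `exp V` sends `w` to `γ 1`, where `γ : ℝ → W` is the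
integral curve `γ' = V ∘ γ`, `γ 0 = w`. (On a closed manifold such a curve exists and is unique for
every smooth field; the value `w` when there is none is a mere default.) -/
noncomputable def expField (V : (w : W) → TangentSpace I w) (w : W) : W :=
  if h : ∃ γ : ℝ → W, γ 0 = w ∧ IsMIntegralCurve (I := I) γ V then h.choose 1 else w

/-- The relative deformation `exp (s V_m)` of `W` obtained by shifting the isolated covariate
channel `m` by the amount `s`. -/
noncomputable def channelDeformation {p : ℕ} (V : Fin p → (w : W) → TangentSpace I w)
    (m : Fin p) (s : ℝ) : W → W :=
  expField I (s • V m)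

/-- Path independence: the deformations induced by arbitrary shifts of two distinct covariate
channels commute under composition. -/
def PathIndependent {p : ℕ} (V : Fin p → (w : W) → TangentSpace I w) : Prop :=
  ∀ m n : Fin p, m ≠ n → ∀ s t : ℝ,
    channelDeformation I V m s ∘ channelDeformation I V n t =
      channelDeformation I V n t ∘ channelDeformation I V m s

/-- `exp (s V)` is the time-`s` map of the flow of `V`: it carries `γ 0` to `γ s` for every integral
curve `γ` of `V`. -/
theorem expField_smul_eq [FiniteDimensional ℝ E] [IsManifold I ∞ W] [BoundarylessManifold I W]
    [T2Space W] {V : (w : W) → TangentSpace I w} (hV : IsVelocityField I V)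
    {γ : ℝ → W} (hγ : IsMIntegralCurve (I := I) γ V) (s : ℝ) :
    expField I (s • V) (γ 0) = γ s := by
  have : CompleteSpace E := FiniteDimensional.complete ℝ E
  have hγs : IsMIntegralCurve (I := I) (γ ∘ (· * s)) (s • V) := hγ.comp_mul s
  have h : ∃ δ : ℝ → W, δ 0 = γ 0 ∧ IsMIntegralCurve (I := I) δ (s • V) :=
    ⟨_, by simp, hγs⟩
  have hVs : ContMDiff I I.tangent 1 (fun w => (⟨w, (s • V) w⟩ : TangentBundle I W)) :=
    ContMDiff.const_smul_section (ContMDiff.of_le hV (by simp))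
  have heq := isMIntegralCurve_Ioo_eq_of_contMDiff_boundaryless (t₀ := 0) hVs
    h.choose_spec.2 hγs (by rw [h.choose_spec.1]; simp)
  rw [expField, dif_pos h, heq]
  simp

end CovariateDeformation

/-! By compactness every velocity field is complete, so `expField` really is its flow. If the flows
commute, `F (s, t) = exp(sV) (exp(tW) p)` has partial derivatives `V ∘ F` and, after swapping the
two flows, `W ∘ F`. In a chart, symmetry of the second derivative of `F` at the origin says exactly
that the bracket vanishes at `p` (`lieBracket_eq_zero_of_hasDerivAt_of_hasDerivAt`).

Conversely, if `[V, W] = 0`, the flow of `V` carries curves tangent to `W` to curves tangent to `W`.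
For short times this is a Grönwall estimate in a chart (`hasDerivAt_flow_of_lieBracket_eq_zero`),
which needs no differentiability of the flow in its initial point; compactness and iteration give
time one. Hence `exp(V)` maps integral curves of `W` to integral curves of `W`, and uniqueness of
these makes the flows commute. -/

/-! ### Flows and Lie brackets in a normed space. -/

section VectorSpace

open Set Filter Metric Topology Function
open scoped NNReal

variable {E : Type*} [NormedAddCommGroup E] [NormedSpace ℝ E]

/-- Integral curves of a `C^1` vector field starting near `x₀` stay near `x₀` for a uniform time. -/
theorem ContDiffAt.exists_nhds_forall_exists_hasDerivAt_mem [CompleteSpace E] {f : E → E} {x₀ : E}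
    (hf : ContDiffAt ℝ 1 f x₀) {N : Set E} (hN : N ∈ 𝓝 x₀) :
    ∃ U ∈ 𝓝 x₀, ∃ ε > 0, ∀ x ∈ U, ∃ α : ℝ → E, α 0 = x ∧
      ∀ t ∈ Ioo (-ε) ε, HasDerivAt α (f (α t)) t ∧ α t ∈ N := by
  obtain ⟨ε, hε, a, r, L, K, hr, hpl⟩ := IsPicardLindelof.of_contDiffAt_one hf
  obtain ⟨α, hα, hc⟩ := (hpl 0).exists_forall_mem_closedBall_eq_hasDerivWithinAt_continuousOn
  have hmem : closedBall x₀ r ×ˢ Icc (0 - ε) (0 + ε) ∈ 𝓝 (x₀, (0 : ℝ)) :=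
    prod_mem_nhds (closedBall_mem_nhds _ hr) (Icc_mem_nhds (by linarith) (by linarith))
  have hca : ContinuousAt α (x₀, 0) := hc.continuousAt hmem
  have h0 : α (x₀, 0) = x₀ := (hα x₀ (mem_closedBall_self r.2)).1
  -- Joint continuity of the local flow at `(x₀, 0)` makes both the neighbourhood and the time
  -- uniform.
  have hpre : α ⁻¹' N ∈ 𝓝 (x₀, (0 : ℝ)) := hca.preimage_mem_nhds (by rwa [h0])
  obtain ⟨U, hU, V, hV, hUV⟩ := mem_nhds_prod_iff.1 (inter_mem hpre hmem)
  obtain ⟨δ, hδ, hδV⟩ := Metric.mem_nhds_iff.1 hV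
  refine ⟨U ∩ closedBall x₀ r, inter_mem hU (closedBall_mem_nhds _ hr), min δ ε, lt_min hδ hε,
    fun x hx ↦ ⟨fun t ↦ α (x, t), (hα x hx.2).1, fun t ht ↦ ⟨?_, ?_⟩⟩⟩
  · have h1 : 0 - ε < t := by linarith [ht.1, min_le_right δ ε]
    have h2 : t < 0 + ε := by linarith [ht.2, min_le_right δ ε]
    exact ((hα x hx.2).2 t ⟨h1.le, h2.le⟩).hasDerivAt (Icc_mem_nhds h1 h2)
  · have : t ∈ V := hδV (by
      rw [mem_ball_zero_iff, Real.norm_eq_abs, abs_lt]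
      exact ⟨by linarith [ht.1, min_le_left δ ε], by linarith [ht.2, min_le_left δ ε]⟩)
    exact (hUV (show (x, t) ∈ U ×ˢ V from ⟨hx.1, this⟩)).1

/-- Separates the initial error from the defect: below the former is `o(h)` and the latter `O(h ^
2)`. -/
theorem gronwallBound_eq_add_mul (δ K ε x : ℝ) :
    gronwallBound δ K ε x = δ * Real.exp (K * x) + ε * gronwallBound 0 K 1 x := by
  unfold gronwallBound
  split_ifs with hK
  · simp [hK]
  · ring

/-- A first order Taylor estimate for a function with Lipschitz derivative. -/
theorem norm_sub_sub_fderiv_le_of_lipschitzOnWith {f : E → E} {N : Set E} {C : ℝ≥0}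
    (hN : Convex ℝ N) (hf : ∀ y ∈ N, DifferentiableAt ℝ f y)
    (hC : LipschitzOnWith C (fderiv ℝ f) N) {y z : E} (hy : y ∈ N) (hz : z ∈ N) :
    ‖f z - f y - fderiv ℝ f y (z - y)‖ ≤ C * ‖z - y‖ ^ 2 := by
  have hseg : segment ℝ y z ⊆ N := hN.segment_subset hy hz
  have := (convex_segment y z).norm_image_sub_le_of_norm_hasFDerivWithin_le' (𝕜 := ℝ) (f := f)
    (f' := fderiv ℝ f) (φ := fderiv ℝ f y) (C := C * ‖z - y‖)
    (fun w hw ↦ (hf w (hseg hw)).hasFDerivAt.hasFDerivWithinAt)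
    (fun w hw ↦ (hC.norm_sub_le (hseg hw) hy).trans (by
      gcongr; exact norm_sub_le_of_mem_segment hw))
    (left_mem_segment ℝ y z) (right_mem_segment ℝ y z)
  linarith [this, sq ‖z - y‖, mul_assoc (C : ℝ) ‖z - y‖ ‖z - y‖]

/-- If `f` and `g` have vanishing Lie bracket, then the flow of `f` maps curves that are tangent to
`g` at time `0` to curves that are tangent to `g` at time `0`. -/
theorem hasDerivAt_flow_of_lieBracket_eq_zero {f g : E → E} {x₀ : E} {r : ℝ} {K C : ℝ≥0} {B : ℝ}
    (hf : ∀ y ∈ ball x₀ r, DifferentiableAt ℝ f y) (hg : ∀ y ∈ ball x₀ r, DifferentiableAt ℝ g y)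
    (hK : LipschitzOnWith K f (ball x₀ r)) (hC : LipschitzOnWith C (fderiv ℝ f) (ball x₀ r))
    (hB : ∀ y ∈ ball x₀ r, ‖g y‖ ≤ B)
    (hfg : ∀ y ∈ ball x₀ r, VectorField.lieBracket ℝ f g y = 0)
    {b : ℝ → ℝ → E} {T : ℝ} (hT : 0 ≤ T)
    (hb : ∀ᶠ h in 𝓝 0, ∀ s ∈ Icc 0 T, HasDerivAt (b h) (f (b h s)) s ∧ b h s ∈ ball x₀ (r / 2))
    (h0 : HasDerivAt (fun h ↦ b h 0) (g (b 0 0)) 0) :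
    HasDerivAt (fun h ↦ b h T) (g (b 0 T)) 0 := by
  have hb0 := hb.self_of_nhds
  have hr : 0 < r := by
    have := (hb0 0 ⟨le_rfl, hT⟩).2
    linarith [pos_of_mem_ball this]
  have hsub : ball x₀ (r / 2) ⊆ ball x₀ r := ball_subset_ball (by linarith)
  have hB0 : 0 ≤ B := (norm_nonneg _).trans (hB _ (hsub (hb0 0 ⟨le_rfl, hT⟩).2))
  have hsmall : ∀ᶠ h : ℝ in 𝓝 0, |h| * B < r / 2 := by
    have : Tendsto (fun h : ℝ ↦ |h| * B) (𝓝 0) (𝓝 (|0| * B)) := by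
      apply Continuous.tendsto; fun_prop
    exact this.eventually_lt_const (by simpa using hr)
  rw [hasDerivAt_iff_isLittleO_nhds_zero] at h0 ⊢
  simp only [zero_add] at h0 ⊢
  have key : ∀ᶠ h in 𝓝 0, ‖b h T - b 0 T - h • g (b 0 T)‖ ≤
      ‖b h 0 - b 0 0 - h • g (b 0 0)‖ * Real.exp (K * T) +
        (C * B ^ 2 * gronwallBound 0 K 1 T) * h ^ 2 := by
    filter_upwards [hb, hsmall] with h hbh hh
    have hmem : ∀ s ∈ Icc 0 T, b 0 s + h • g (b 0 s) ∈ ball x₀ r := by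
      intro s hs
      have h1 := (hb0 s hs).2
      rw [mem_ball, dist_eq_norm] at h1 ⊢
      have h2 := hB _ (hsub (hb0 s hs).2)
      calc ‖b 0 s + h • g (b 0 s) - x₀‖ = ‖(b 0 s - x₀) + h • g (b 0 s)‖ := by congr 1; abel
        _ ≤ ‖b 0 s - x₀‖ + |h| * ‖g (b 0 s)‖ := by
          refine (norm_add_le _ _).trans ?_
          rw [norm_smul, Real.norm_eq_abs]
        _ ≤ ‖b 0 s - x₀‖ + |h| * B := by gcongr
        _ < r := by linarith
    -- The comparison curve is the first-order guess for `b h`. The vanishing bracket replaces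
    -- `Dg(f)` by `Df(g)` in its velocity, which then agrees with `f` along the curve up to the
    -- Taylor remainder `C * B ^ 2 * h ^ 2`.
    have hc' : ∀ s ∈ Icc 0 T, HasDerivAt (fun s ↦ b 0 s + h • g (b 0 s))
        (f (b 0 s) + h • fderiv ℝ f (b 0 s) (g (b 0 s))) s := by
      intro s hs
      have h1 := (hg _ (hsub (hb0 s hs).2)).hasFDerivAt.comp_hasDerivAt s (hb0 s hs).1
      have h2 := hfg _ (hsub (hb0 s hs).2)
      rw [VectorField.lieBracket, sub_eq_zero] at h2
      rw [← h2]
      exact (hb0 s hs).1.add (h1.const_smul h)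
    have hgron := dist_le_of_approx_trajectories_ODE_of_mem (v := fun _ ↦ f)
      (s := fun _ ↦ ball x₀ r) (K := K) (a := 0) (b := T) (f := b h)
      (g := fun s ↦ b 0 s + h • g (b 0 s)) (f' := fun s ↦ f (b h s))
      (g' := fun s ↦ f (b 0 s) + h • fderiv ℝ f (b 0 s) (g (b 0 s)))
      (εf := 0) (εg := C * B ^ 2 * h ^ 2) (δ := ‖b h 0 - b 0 0 - h • g (b 0 0)‖)
      (fun _ _ ↦ hK) (fun s hs ↦ (hbh s hs).1.continuousAt.continuousWithinAt)
      (fun s hs ↦ (hbh s (Ico_subset_Icc_self hs)).1.hasDerivWithinAt)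
      (fun s hs ↦ by simp) (fun s hs ↦ hsub (hbh s (Ico_subset_Icc_self hs)).2)
      (fun s hs ↦ (hc' s hs).continuousAt.continuousWithinAt)
      (fun s hs ↦ (hc' s (Ico_subset_Icc_self hs)).hasDerivWithinAt)
      (fun s hs ↦ by
        have hs' := Ico_subset_Icc_self hs
        have h1 := norm_sub_sub_fderiv_le_of_lipschitzOnWith (convex_ball x₀ r) hf hC
          (hsub (hb0 s hs').2) (hmem s hs')
        rw [add_sub_cancel_left, map_smul, norm_smul, Real.norm_eq_abs, mul_pow, sq_abs] at h1
        have h2 := hB _ (hsub (hb0 s hs').2)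
        rw [dist_comm, dist_eq_norm, ← sub_sub]
        refine h1.trans ?_
        calc (C : ℝ) * (h ^ 2 * ‖g (b 0 s)‖ ^ 2) ≤ C * (h ^ 2 * B ^ 2) := by gcongr
          _ = C * B ^ 2 * h ^ 2 := by ring)
      (fun s hs ↦ hmem s (Ico_subset_Icc_self hs))
      (by rw [dist_eq_norm, sub_add_eq_sub_sub]) T ⟨hT, le_rfl⟩
    rw [dist_eq_norm, gronwallBound_eq_add_mul, sub_zero, sub_add_eq_sub_sub] at hgron
    linarith
  refine Asymptotics.IsBigO.trans_isLittleO (g := fun h : ℝ ↦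
      ‖b h 0 - b 0 0 - h • g (b 0 0)‖ * Real.exp (K * T) +
        (C * B ^ 2 * gronwallBound 0 K 1 T) * h ^ 2) (.of_bound 1 ?_) ?_
  · filter_upwards [key] with h hh
    rw [one_mul]
    exact hh.trans (le_abs_self _)
  · refine Asymptotics.IsLittleO.add ?_ ?_
    · simpa only [mul_comm] using h0.norm_left.const_mul_left (Real.exp (K * T))
    · exact (Asymptotics.isLittleO_pow_id one_lt_two).const_mul_left _

/-- If a two-parameter family is an integral curve of `f` in the first and of `g` in the second
parameter, then the Lie bracket of `f` and `g` vanishes at the base point. -/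
theorem lieBracket_eq_zero_of_hasDerivAt_of_hasDerivAt {f g : E → E} {F : ℝ → ℝ → E}
    (hf : ContDiffAt ℝ 1 f (F 0 0)) (hg : ContDiffAt ℝ 1 g (F 0 0))
    (hF : ContinuousAt (uncurry F) (0, 0))
    (h₁ : ∀ᶠ v : ℝ × ℝ in 𝓝 (0, 0), HasDerivAt (F · v.2) (f (F v.1 v.2)) v.1)
    (h₂ : ∀ᶠ v : ℝ × ℝ in 𝓝 (0, 0), HasDerivAt (F v.1 ·) (g (F v.1 v.2)) v.2) :
    VectorField.lieBracket ℝ f g (F 0 0) = 0 := by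
  have hfF : ContinuousAt (fun v : ℝ × ℝ ↦ f (F v.1 v.2)) (0, 0) :=
    ContinuousAt.comp (f := uncurry F) (g := f) hf.continuousAt hF
  have hbdd : ∀ᶠ v : ℝ × ℝ in 𝓝 (0, 0), ‖f (F v.1 v.2)‖ < ‖f (F 0 0)‖ + 1 :=
    hfF.norm.eventually_lt_const (lt_add_one _)
  -- Continuity at the origin alone spreads to a neighbourhood: `f ∘ F` is bounded there, so `F` is
  -- uniformly Lipschitz in the first variable, and it is continuous in the second.
  have hcont : ∀ᶠ v : ℝ × ℝ in 𝓝 (0, 0), ContinuousAt (uncurry F) v := by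
    obtain ⟨ε, hε, hball⟩ := Metric.eventually_nhds_iff_ball.1 (h₁.and (h₂.and hbdd))
    rw [← ball_prod_same] at hball
    have : ContinuousOn (uncurry F) (ball (0 : ℝ) ε ×ˢ ball (0 : ℝ) ε) := by
      refine continuousOn_prod_of_continuousOn_lipschitzOnWith _ (‖f (F 0 0)‖₊ + 1)
        (fun s hs t ht ↦ ?_) (fun t ht ↦ ?_)
      · exact (hball (s, t) ⟨hs, ht⟩).2.1.continuousAt.continuousWithinAt
      · refine (convex_ball (0 : ℝ) ε).lipschitzOnWith_of_nnnorm_hasDerivWithin_le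
          (f' := fun s ↦ f (F s t))
          (fun s hs ↦ (hball (s, t) ⟨hs, ht⟩).1.hasDerivWithinAt) (fun s hs ↦ ?_)
        exact_mod_cast (hball (s, t) ⟨hs, ht⟩).2.2.le
    have hn : ball (0 : ℝ) ε ×ˢ ball (0 : ℝ) ε ∈ 𝓝 ((0 : ℝ), (0 : ℝ)) :=
      prod_mem_nhds (ball_mem_nhds _ hε) (ball_mem_nhds _ hε)
    filter_upwards [eventually_mem_nhds_iff.2 hn] with v hv using this.continuousAt hv
  have hfc : ∀ᶠ v : ℝ × ℝ in 𝓝 (0, 0), ContinuousAt f (F v.1 v.2) :=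
    hF.eventually ((hf.eventually (by simp)).mono fun _ h ↦ h.continuousAt)
  have hgc : ∀ᶠ v : ℝ × ℝ in 𝓝 (0, 0), ContinuousAt g (F v.1 v.2) :=
    hF.eventually ((hg.eventually (by simp)).mono fun _ h ↦ h.continuousAt)
  let F' : ℝ × ℝ → ℝ × ℝ →L[ℝ] E := fun v ↦
    (ContinuousLinearMap.fst ℝ ℝ ℝ).smulRight (f (uncurry F v)) +
      (ContinuousLinearMap.snd ℝ ℝ ℝ).smulRight (g (uncurry F v))
  have hF' : ∀ᶠ v in 𝓝 ((0 : ℝ), (0 : ℝ)), HasFDerivAt (uncurry F) (F' v) v := by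
    filter_upwards [h₁.eventually_nhds, h₂.eventually_nhds, hcont, hfc, hgc]
      with v h1 h2 hc hfv hgv
    have := hasStrictFDerivAt_uncurry_coprod (𝕜 := ℝ) (u := v) (f := F)
      (f₁ := fun s t ↦ ContinuousLinearMap.toSpanSingleton ℝ (f (F s t)))
      (f₂ := fun s t ↦ ContinuousLinearMap.toSpanSingleton ℝ (g (F s t)))
      (h1.mono fun w hw ↦ hw.hasFDerivAt) (h2.mono fun w hw ↦ hw.hasFDerivAt)
      ((ContinuousLinearMap.toSpanSingletonCLE (𝕜 := ℝ) (E := E)).continuous.continuousAt.comp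
        (ContinuousAt.comp (f := uncurry F) (g := f) hfv hc))
      ((ContinuousLinearMap.toSpanSingletonCLE (𝕜 := ℝ) (E := E)).continuous.continuousAt.comp
        (ContinuousAt.comp (f := uncurry F) (g := g) hgv hc))
    refine this.hasFDerivAt.congr_fderiv ?_
    ext <;> simp [F', HasUncurry.uncurry, uncurry]
  have h00 := hF'.self_of_nhds
  have hfd := ((hf.differentiableAt one_ne_zero).hasFDerivAt (x := uncurry F (0, 0))).comp
    ((0 : ℝ), (0 : ℝ)) h00
  have hgd := ((hg.differentiableAt one_ne_zero).hasFDerivAt (x := uncurry F (0, 0))).comp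
    ((0 : ℝ), (0 : ℝ)) h00
  have hF'' := ((ContinuousLinearMap.smulRightL ℝ (ℝ × ℝ) E
      (ContinuousLinearMap.fst ℝ ℝ ℝ)).hasFDerivAt.comp ((0 : ℝ), (0 : ℝ)) hfd).add
    ((ContinuousLinearMap.smulRightL ℝ (ℝ × ℝ) E
      (ContinuousLinearMap.snd ℝ ℝ ℝ)).hasFDerivAt.comp ((0 : ℝ), (0 : ℝ)) hgd)
  -- The two mixed second derivatives are `Dg(f)` and `Df(g)`.
  have hsymm := second_derivative_symmetric_of_eventually (f' := F') hF' hF'' (1, 0) (0, 1)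
  simp [F', uncurry] at hsymm
  rw [VectorField.lieBracket, sub_eq_zero]
  exact hsymm

end VectorSpace

/-! ### Vector fields, curves and brackets read in a chart. -/

section Chart

open Set Filter Metric Topology Function
open scoped NNReal

open VectorField

variable {E : Type*} [NormedAddCommGroup E] [NormedSpace ℝ E]
  {H : Type*} [TopologicalSpace H] {I : ModelWithCorners ℝ E H}
  {M : Type*} [TopologicalSpace M] [ChartedSpace H M]

variable (I) in
/-- The expression of a vector field in the preferred extended chart at `p`. -/
noncomputable def chartField (p : M) (V : (x : M) → TangentSpace I x) : E → E :=
  mpullbackWithin 𝓘(ℝ, E) I (extChartAt I p).symm V (range I)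

theorem chartField_extChartAt [IsManifold I 1 M] {p x : M} (hx : x ∈ (extChartAt I p).source)
    (V : (x : M) → TangentSpace I x) :
    chartField I p V (extChartAt I p x) = mfderiv I 𝓘(ℝ, E) (extChartAt I p) x (V x) := by
  have hinv : (mfderivWithin 𝓘(ℝ, E) I (extChartAt I p).symm (range I) (extChartAt I p x)).inverse
      = mfderiv I 𝓘(ℝ, E) (extChartAt I p) ((extChartAt I p).symm (extChartAt I p x)) :=
    ContinuousLinearMap.inverse_eq
      (mfderivWithin_extChartAt_symm_comp_mfderiv_extChartAt ((extChartAt I p).map_source hx))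
      (mfderiv_extChartAt_comp_mfderivWithin_extChartAt_symm ((extChartAt I p).map_source hx))
  rw [chartField, mpullbackWithin_apply, hinv, (extChartAt I p).left_inv hx]


/-- The derivative of a curve tangent to a vector field, read in a chart. -/
theorem HasMFDerivAt.hasDerivAt_extChartAt_comp [IsManifold I 1 M]
    {V : (x : M) → TangentSpace I x} {p : M} {γ : ℝ → M} {t : ℝ}
    (h : HasMFDerivAt 𝓘(ℝ, ℝ) I γ t ((1 : ℝ →L[ℝ] ℝ).smulRight (V (γ t))))
    (hs : γ t ∈ (extChartAt I p).source) :
    HasDerivAt (fun u ↦ extChartAt I p (γ u)) (chartField I p V (extChartAt I p (γ t))) t := by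
  have hs' : γ t ∈ (chartAt H p).source := by rwa [← extChartAt_source (I := I)]
  rw [chartField_extChartAt hs]
  have hd := (mdifferentiableAt_extChartAt (I := I) hs').hasMFDerivAt.comp t h
  let L : ℝ →L[ℝ] E := ContinuousLinearMap.comp (mfderiv I 𝓘(ℝ, E) (extChartAt I p) (γ t))
    ((1 : ℝ →L[ℝ] ℝ).smulRight (V (γ t)))
  have hL : HasFDerivAt (fun u ↦ extChartAt I p (γ u)) L t := hasMFDerivAt_iff_hasFDerivAt.1 hd
  refine hL.hasDerivAt.congr_deriv ?_
  change mfderiv I 𝓘(ℝ, E) (extChartAt I p) (γ t) ((1 : ℝ) • (V (γ t))) = _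
  rw [one_smul]

/-- A curve in the chart domain tangent to the expression of a vector field in the chart is tangent
to the vector field. -/
theorem hasMFDerivAt_extChartAt_symm_comp_of_hasDerivAt [IsManifold I 1 M]
    {V : (x : M) → TangentSpace I x} {p : M} {σ : ℝ → E} {t : ℝ}
    (h : HasDerivAt σ (chartField I p V (σ t)) t) (hs : (extChartAt I p).target ∈ 𝓝 (σ t)) :
    HasMFDerivAt 𝓘(ℝ, ℝ) I (fun u ↦ (extChartAt I p).symm (σ u)) t
      ((1 : ℝ →L[ℝ] ℝ).smulRight (V ((extChartAt I p).symm (σ t)))) := by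
  have htar : σ t ∈ (extChartAt I p).target := mem_of_mem_nhds hs
  have h1 := (mdifferentiableWithinAt_extChartAt_symm (I := I) htar).hasMFDerivWithinAt
  have h2 := (h1.hasMFDerivAt (mem_of_superset hs (extChartAt_target_subset_range p))).comp t
    h.hasFDerivAt.hasMFDerivAt
  refine h2.congr_mfderiv ?_
  refine ContinuousLinearMap.ext_ring ?_
  change mfderivWithin 𝓘(ℝ, E) I (extChartAt I p).symm (range I) (σ t)
    ((1 : ℝ) • chartField I p V (σ t)) = (1 : ℝ) • V ((extChartAt I p).symm (σ t))
  rw [one_smul, one_smul, chartField, mpullbackWithin_apply]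
  exact (isInvertible_mfderivWithin_extChartAt_symm htar).self_apply_inverse _

theorem extChartAt_target_mem_nhds_self [BoundarylessManifold I M] (p : M) :
    (extChartAt I p).target ∈ 𝓝 (extChartAt I p p) :=
  mem_interior_iff_mem_nhds.1 (I.isInteriorPoint_iff.1 BoundarylessManifold.isInteriorPoint)

/-- Class `C^2` suffices: it makes the derivative locally Lipschitz, as the Taylor estimate
requires. -/
theorem contDiffAt_chartField [CompleteSpace E] [IsManifold I ∞ M] [BoundarylessManifold I M]
    {V : (x : M) → TangentSpace I x}
    (hV : ContMDiff I I.tangent ∞ (fun x => (⟨x, V x⟩ : TangentBundle I M))) (p : M) :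
    ContDiffAt ℝ 2 (chartField I p V) (extChartAt I p p) := by
  have : IsManifold I (2 + 1) M := IsManifold.of_le (m := 2 + 1) (n := ∞) (by norm_cast)
  have h := contMDiffWithinAt_mpullbackWithin_extChartAt_symm (n := 2 + 1) (m := 2) (s := univ)
    (hV.of_le (by norm_cast)).contMDiffAt.contMDiffWithinAt uniqueMDiffOn_univ (mem_univ p) le_rfl
  rw [preimage_univ, inter_univ] at h
  exact (contMDiffWithinAt_vectorSpace_iff_contDiffWithinAt.1 h).contDiffAt
    (extChartAt_target_mem_nhds_self p)

/-- The expression in a chart of the Lie bracket is the Lie bracket of the expressions. -/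
theorem chartField_mlieBracket [CompleteSpace E] [IsManifold I ∞ M]
    {V W : (x : M) → TangentSpace I x}
    (hV : ContMDiff I I.tangent ∞ (fun x => (⟨x, V x⟩ : TangentBundle I M)))
    (hW : ContMDiff I I.tangent ∞ (fun x => (⟨x, W x⟩ : TangentBundle I M))) {p : M} {y : E}
    (hy : (extChartAt I p).target ∈ 𝓝 y) :
    chartField I p (mlieBracket I V W) y =
      lieBracket ℝ (chartField I p V) (chartField I p W) y := by
  have hyt := mem_of_mem_nhds hy
  have : IsManifold I 2 M := IsManifold.of_le (m := 2) (n := ∞) (by norm_cast)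
  have hyr := extChartAt_target_subset_range p hyt
  have : IsManifold I (minSmoothness ℝ 3) M :=
    IsManifold.of_le (m := minSmoothness ℝ 3) (n := ∞) (by simp; norm_cast)
  have h := mpullbackWithin_mlieBracketWithin (I := 𝓘(ℝ, E)) (I' := I) (n := 2)
    (f := (extChartAt I p).symm) (V := V) (W := W) (x₀ := y) (s := range I) (t := univ)
    (hV.mdifferentiable (by simp) _).mdifferentiableWithinAt
    (hW.mdifferentiable (by simp) _).mdifferentiableWithinAt I.uniqueMDiffOn
    (contMDiffWithinAt_extChartAt_symm_range (n := 2) p hyt) hyr (by simp)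
    (by simp) (by
      refine subset_closure (mem_interior_iff_mem_nhds.2 ?_)
      exact mem_of_superset hy (extChartAt_target_subset_range p))
  rw [mlieBracketWithin_univ, mlieBracketWithin_eq_lieBracketWithin] at h
  have h' : lieBracketWithin ℝ (chartField I p V) (chartField I p W) (range I) y =
      lieBracket ℝ (chartField I p V) (chartField I p W) y :=
    lieBracketWithin_of_mem_nhds (mem_of_superset hy (extChartAt_target_subset_range p))
  exact h.trans h'

end Chart

/-! ### Global flows on a compact manifold and their commutation. -/

section Flow

open Set Filter Metric Topology Function
open scoped NNReal

open VectorField CovariateDeformation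

variable {E : Type*} [NormedAddCommGroup E] [NormedSpace ℝ E]
  {H : Type*} [TopologicalSpace H] {I : ModelWithCorners ℝ E H}
  {M : Type*} [TopologicalSpace M] [ChartedSpace H M] [IsManifold I ∞ M]
  {V W : (x : M) → TangentSpace I x}

/-- On a compact space, a property that holds locally for small positive parameters holds
everywhere for some positive parameter. -/
theorem exists_pos_forall_of_forall_exists_nhds {X : Type*} [TopologicalSpace X] [CompactSpace X]
    {P : ℝ → X → Prop} (hmono : ∀ ⦃δ ε x⦄, δ ≤ ε → P ε x → P δ x)
    (hloc : ∀ p, ∃ U ∈ 𝓝 p, ∃ ε > 0, ∀ x ∈ U, P ε x) : ∃ ε > 0, ∀ x, P ε x := by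
  obtain ⟨ε, hε, h⟩ := isCompact_univ.induction_on (p := fun s : Set X ↦ ∃ ε > 0, ∀ x ∈ s, P ε x)
    ⟨1, one_pos, by simp⟩ (fun s t hst ⟨ε, hε, h⟩ ↦ ⟨ε, hε, fun x hx ↦ h x (hst hx)⟩)
    (fun s t ⟨ε, hε, h⟩ ⟨δ, hδ, h'⟩ ↦ ⟨min ε δ, lt_min hε hδ, fun x hx ↦
      hx.elim (fun hx ↦ hmono (min_le_left _ _) (h x hx))
        fun hx ↦ hmono (min_le_right _ _) (h' x hx)⟩)
    (fun p _ ↦ by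
      obtain ⟨U, hU, h⟩ := hloc p
      exact ⟨U, mem_nhdsWithin_of_mem_nhds hU, h⟩)
  exact ⟨ε, hε, fun x ↦ h x (mem_univ x)⟩

namespace CovariateDeformation

theorem IsVelocityField.contMDiff_one (hV : IsVelocityField I V) :
    ContMDiff I I.tangent 1 (fun x => (⟨x, V x⟩ : TangentBundle I M)) :=
  ContMDiff.of_le hV (by simp)

theorem IsVelocityField.smul (hV : IsVelocityField I V) (s : ℝ) : IsVelocityField I (s • V) :=
  ContMDiff.const_smul_section hV

variable [FiniteDimensional ℝ E] [BoundarylessManifold I M]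

/-- Integral curves starting near `p` stay near `p` for a uniform time. -/
theorem IsVelocityField.exists_isMIntegralCurveOn_mem (hV : IsVelocityField I V) {p : M} {N : Set M}
    (hN : N ∈ 𝓝 p) : ∃ U ∈ 𝓝 p, ∃ ε > 0, ∀ x ∈ U, ∃ γ : ℝ → M, γ 0 = x ∧
      IsMIntegralCurveOn (I := I) γ V (Ioo (-ε) ε) ∧ ∀ t ∈ Ioo (-ε) ε, γ t ∈ N := by
  have : CompleteSpace E := FiniteDimensional.complete ℝ E
  have : IsManifold I 1 M := IsManifold.of_le (m := 1) (n := ∞) (by simp)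
  have hN' : (extChartAt I p).symm ⁻¹' N ∩ interior (extChartAt I p).target ∈
      𝓝 (extChartAt I p p) :=
    inter_mem ((continuousAt_extChartAt_symm p).preimage_mem_nhds (by simpa using hN))
      (interior_mem_nhds.2 (extChartAt_target_mem_nhds_self p))
  obtain ⟨U, hU, ε, hε, h⟩ := ((contDiffAt_chartField hV p).of_le
    (by norm_num)).exists_nhds_forall_exists_hasDerivAt_mem hN'
  refine ⟨(extChartAt I p).source ∩ extChartAt I p ⁻¹' U,
    inter_mem (extChartAt_source_mem_nhds p) ((continuousAt_extChartAt p).preimage_mem_nhds hU),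
    ε, hε, fun x hx ↦ ?_⟩
  obtain ⟨α, hα, h⟩ := h _ hx.2
  refine ⟨fun t ↦ (extChartAt I p).symm (α t), ?_, fun t ht ↦ ?_, fun t ht ↦ (h t ht).2.1⟩
  · simp only [hα, (extChartAt I p).left_inv hx.1]
  · exact (hasMFDerivAt_extChartAt_symm_comp_of_hasDerivAt (h t ht).1
      (mem_interior_iff_mem_nhds.1 (h t ht).2.2)).hasMFDerivWithinAt

variable [T2Space M] [CompactSpace M]

/-- Compactness gives one existence time valid at all points, and local curves with a uniform
lifetime extend to all of `ℝ`. -/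
theorem IsVelocityField.exists_isMIntegralCurve (hV : IsVelocityField I V) (x : M) :
    ∃ γ : ℝ → M, γ 0 = x ∧ IsMIntegralCurve (I := I) γ V := by
  have : IsManifold I 1 M := IsManifold.of_le (m := 1) (n := ∞) (by simp)
  obtain ⟨ε, hε, h⟩ := exists_pos_forall_of_forall_exists_nhds
    (P := fun ε x ↦ ∃ γ : ℝ → M, γ 0 = x ∧ IsMIntegralCurveOn (I := I) γ V (Ioo (-ε) ε))
    (fun δ ε x hδ ⟨γ, h0, h⟩ ↦ ⟨γ, h0, h.mono (Ioo_subset_Ioo (neg_le_neg hδ) hδ)⟩)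
    (fun p ↦ by
      obtain ⟨U, hU, ε, hε, h⟩ := hV.exists_isMIntegralCurveOn_mem (p := p) univ_mem
      exact ⟨U, hU, ε, hε, fun x hx ↦ (h x hx).imp fun γ hγ ↦ ⟨hγ.1, hγ.2.1⟩⟩)
  exact exists_isMIntegralCurve_of_isMIntegralCurveOn hV.contMDiff_one hε h x

theorem IsVelocityField.exists_isMIntegralCurve_eq_expField (hV : IsVelocityField I V) (x : M) :
    ∃ γ : ℝ → M, γ 0 = x ∧ IsMIntegralCurve (I := I) γ V ∧ ∀ s, expField I (s • V) x = γ s := by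
  obtain ⟨γ, rfl, hγ⟩ := hV.exists_isMIntegralCurve x
  exact ⟨γ, rfl, hγ, expField_smul_eq I hV hγ⟩

theorem IsVelocityField.isMIntegralCurve_expField (hV : IsVelocityField I V) (x : M) :
    IsMIntegralCurve (I := I) (fun s : ℝ ↦ expField I (s • V) x) V := by
  obtain ⟨γ, -, hγ, h⟩ := hV.exists_isMIntegralCurve_eq_expField x
  rwa [funext h]

theorem IsVelocityField.expField_zero_smul (hV : IsVelocityField I V) (x : M) :
    expField I ((0 : ℝ) • V) x = x := by
  obtain ⟨γ, h0, -, h⟩ := hV.exists_isMIntegralCurve_eq_expField x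
  rw [h, h0]

theorem IsVelocityField.expField_add_smul (hV : IsVelocityField I V) (s t : ℝ) (x : M) :
    expField I ((s + t) • V) x = expField I (s • V) (expField I (t • V) x) := by
  have := expField_smul_eq I hV ((hV.isMIntegralCurve_expField x).comp_add t) s
  simp only [comp_apply, zero_add] at this
  exact this.symm

/-- The flow is jointly continuous at time `0`. -/
theorem IsVelocityField.exists_forall_expField_mem (hV : IsVelocityField I V) {p : M} {N : Set M}
    (hN : N ∈ 𝓝 p) :
    ∃ U ∈ 𝓝 p, ∃ ε > (0 : ℝ), ∀ x ∈ U, ∀ s ∈ Ioo (-ε) ε, expField I (s • V) x ∈ N := by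
  have : IsManifold I 1 M := IsManifold.of_le (m := 1) (n := ∞) (by simp)
  obtain ⟨U, hU, ε, hε, h⟩ := hV.exists_isMIntegralCurveOn_mem hN
  refine ⟨U, hU, ε, hε, fun x hx s hs ↦ ?_⟩
  obtain ⟨γ, h0, hγ, hmem⟩ := h x hx
  have := isMIntegralCurveOn_Ioo_eqOn_of_contMDiff_boundaryless (t₀ := 0)
    ⟨neg_lt_zero.2 hε, hε⟩ hV.contMDiff_one
    ((hV.isMIntegralCurve_expField x).isMIntegralCurveOn (Ioo (-ε) ε)) hγ
    (by rw [hV.expField_zero_smul, h0]) hs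
  simp only at this
  rw [this]
  exact hmem s hs

variable (W) in
/-- The map `Φ` sends curves through `x` that are tangent to the vector field `W` at time `0` to
curves that are tangent to `W` at time `0`. -/
def PreservesTangency (Φ : M → M) (x : M) : Prop :=
  ∀ c : ℝ → M, c 0 = x → HasMFDerivAt 𝓘(ℝ, ℝ) I c 0 ((1 : ℝ →L[ℝ] ℝ).smulRight (W (c 0))) →
    HasMFDerivAt 𝓘(ℝ, ℝ) I (fun h ↦ Φ (c h)) 0 ((1 : ℝ →L[ℝ] ℝ).smulRight (W (Φ (c 0))))

/-- For short times the flow stays in one chart, within half the radius on which the Lipschitz and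
boundedness estimates hold, so the Grönwall argument applies. -/
theorem IsVelocityField.exists_forall_preservesTangency (hV : IsVelocityField I V)
    (hW : IsVelocityField I W) (hVW : ∀ x, mlieBracket I V W x = 0) (p : M) :
    ∃ U ∈ 𝓝 p, ∃ ε > (0 : ℝ), ∀ x ∈ U, ∀ T ∈ Ico 0 ε, PreservesTangency W (expField I (T • V)) x := by
  have : CompleteSpace E := FiniteDimensional.complete ℝ E
  have : IsManifold I 1 M := IsManifold.of_le (m := 1) (n := ∞) (by simp)
  have hf := contDiffAt_chartField hV p
  have hg := contDiffAt_chartField hW p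
  obtain ⟨K, sK, hsK, hK⟩ := (hf.of_le (m := 1) (by norm_num)).exists_lipschitzOnWith
  obtain ⟨C, sC, hsC, hC⟩ :=
    (hf.fderiv_right (m := 1) (by norm_num)).exists_lipschitzOnWith
  have hfd := (hf.eventually (by simp)).mono fun y hy ↦ hy.differentiableAt two_ne_zero
  have hgd := (hg.eventually (by simp)).mono fun y hy ↦ hy.differentiableAt two_ne_zero
  have hgB := hg.continuousAt.norm.eventually_lt_const
    (lt_add_one ‖chartField I p W (extChartAt I p p)‖)
  obtain ⟨r, hr, hball⟩ := Metric.eventually_nhds_iff_ball.1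
    ((hfd.and hgd).and ((hgB.and (eventually_mem_nhds_iff.2 (extChartAt_target_mem_nhds_self p))).and
      ((eventually_mem_set.2 hsK).and (eventually_mem_set.2 hsC))))
  obtain ⟨U, hU, ε, hε, hflow⟩ := hV.exists_forall_expField_mem (p := p)
    (N := (extChartAt I p).source ∩ extChartAt I p ⁻¹' ball (extChartAt I p p) (r / 2))
    (inter_mem (extChartAt_source_mem_nhds p)
      ((continuousAt_extChartAt p).preimage_mem_nhds (ball_mem_nhds _ (by linarith))))
  refine ⟨interior U, interior_mem_nhds.2 hU, ε, hε, fun x hx T hT c hc hcW ↦ ?_⟩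
  subst hc
  have hcU : ∀ᶠ h in 𝓝 0, c h ∈ U :=
    hcW.continuousAt.preimage_mem_nhds (mem_interior_iff_mem_nhds.1 hx)
  have hIoo : ∀ s ∈ Icc 0 T, s ∈ Ioo (-ε) ε := fun s hs ↦
    ⟨by linarith [hs.1], hs.2.trans_lt hT.2⟩
  have hsrc : c 0 ∈ (extChartAt I p).source := by
    have := (hflow _ hcU.self_of_nhds 0 ⟨by linarith, hε⟩).1
    rwa [hV.expField_zero_smul] at this
  have hd := hasDerivAt_flow_of_lieBracket_eq_zero
    (b := fun h s ↦ extChartAt I p (expField I (s • V) (c h))) (r := r) (T := T)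
    (fun y hy ↦ (hball y hy).1.1) (fun y hy ↦ (hball y hy).1.2)
    (hK.mono fun y hy ↦ (hball y hy).2.2.1) (hC.mono fun y hy ↦ (hball y hy).2.2.2)
    (fun y hy ↦ (hball y hy).2.1.1.le)
    (fun y hy ↦ by
      rw [← chartField_mlieBracket hV hW (hball y hy).2.1.2, chartField, mpullbackWithin_apply,
        hVW]
      exact map_zero _) hT.1
    (hcU.mono fun h hh s hs ↦ ⟨HasMFDerivAt.hasDerivAt_extChartAt_comp
      (hV.isMIntegralCurve_expField (c h) s) (hflow _ hh s (hIoo s hs)).1,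
      (hflow _ hh s (hIoo s hs)).2⟩)
    (by
      simp only [hV.expField_zero_smul]
      exact hcW.hasDerivAt_extChartAt_comp hsrc)
  have hTε := hIoo T ⟨hT.1, le_rfl⟩
  have hmem := hflow _ hcU.self_of_nhds T hTε
  have hM := hasMFDerivAt_extChartAt_symm_comp_of_hasDerivAt hd
    (hball _ (ball_subset_ball (by linarith) hmem.2)).2.1.2
  rw [(extChartAt I p).left_inv hmem.1] at hM
  refine hM.congr_of_eventuallyEq (hcU.mono fun h hh ↦ ?_)
  exact ((extChartAt I p).left_inv (hflow _ hh T hTε).1).symm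

/-- The flow of a vector field commuting with `W` preserves tangency to `W`. -/
theorem IsVelocityField.preservesTangency_expField (hV : IsVelocityField I V)
    (hW : IsVelocityField I W) (hVW : ∀ x, mlieBracket I V W x = 0) (x : M) :
    PreservesTangency W (expField I V) x := by
  obtain ⟨ε, hε, h⟩ := exists_pos_forall_of_forall_exists_nhds
    (P := fun ε x ↦ ∀ T ∈ Ico 0 ε, PreservesTangency W (expField I (T • V)) x)
    (fun δ ε x hδ h T hT ↦ h T ⟨hT.1, hT.2.trans_le hδ⟩)
    (hV.exists_forall_preservesTangency hW hVW)
  obtain ⟨n, hn⟩ := exists_nat_one_div_lt hε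
  -- Time one is reached in `n + 1` steps, each shorter than the uniform `ε`.
  have hk : ∀ k : ℕ, PreservesTangency W (expField I ((k * (1 / ((n : ℝ) + 1))) • V)) x := by
    intro k
    induction k with
    | zero =>
      have h0 : expField I (((0 : ℕ) * (1 / ((n : ℝ) + 1))) • V) = id := by
        funext y
        rw [Nat.cast_zero, zero_mul, hV.expField_zero_smul, id]
      rw [h0]
      exact fun c _ hcW ↦ hcW
    | succ k ih =>
      have h1 : expField I (((k + 1 : ℕ) * (1 / ((n : ℝ) + 1))) • V) = fun y ↦
          expField I ((1 / ((n : ℝ) + 1)) • V) (expField I ((k * (1 / ((n : ℝ) + 1))) • V) y) := by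
        funext y
        rw [← hV.expField_add_smul]
        push_cast
        ring_nf
      rw [h1]
      exact fun c hc hcW ↦ h _ _ ⟨by positivity, hn⟩ _ rfl (ih c hc hcW)
  have h1 := hk (n + 1)
  have h2 : (((n + 1 : ℕ) : ℝ) * (1 / ((n : ℝ) + 1))) = 1 := by
    push_cast
    field_simp
  rwa [h2, one_smul] at h1

/-- The flows of commuting vector fields commute. -/
theorem IsVelocityField.expField_comm (hV : IsVelocityField I V)
    (hW : IsVelocityField I W) (hVW : ∀ x, mlieBracket I V W x = 0) (x : M) :
    expField I V (expField I W x) = expField I W (expField I V x) := by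
  have hη : IsMIntegralCurve (I := I) (fun t : ℝ ↦ expField I V (expField I (t • W) x)) W := by
    intro t
    -- Tangency preservation is stated at parameter `0`, so the curve is shifted by `t` and then
    -- shifted back.
    have h1 : HasMFDerivAt 𝓘(ℝ, ℝ) I
        (fun h : ℝ ↦ expField I V (expField I ((h + t) • W) x)) (t - t)
        ((1 : ℝ →L[ℝ] ℝ).smulRight (W (expField I V (expField I (t • W) x)))) := by
      have := hV.preservesTangency_expField hW hVW _ _ rfl
        ((hW.isMIntegralCurve_expField x).comp_add t 0)
      rw [sub_self]
      refine this.congr_mfderiv (congrArg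
        (fun y ↦ ((1 : ℝ →L[ℝ] ℝ).smulRight (W y : E) : ℝ →L[ℝ] E)) ?_)
      simp only [comp_apply, zero_add]
    have h2 : HasMFDerivAt 𝓘(ℝ, ℝ) 𝓘(ℝ, ℝ) (fun u : ℝ ↦ u - t) t (1 : ℝ →L[ℝ] ℝ) :=
      ((hasFDerivAt_id t).sub_const t).hasMFDerivAt
    have h3 := HasMFDerivAt.comp (f := fun u : ℝ ↦ u - t) t h1 h2
    refine (h3.congr_mfderiv (ContinuousLinearMap.ext_ring rfl)).congr_of_eventuallyEq
      (.of_forall fun u ↦ ?_)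
    simp only [comp_apply, sub_add_cancel]
  have := expField_smul_eq I hW hη 1
  simp only [hW.expField_zero_smul, one_smul] at this
  exact this.symm

/-- If the flows of two vector fields commute, then their Lie bracket vanishes. -/
theorem IsVelocityField.mlieBracket_eq_zero (hV : IsVelocityField I V) (hW : IsVelocityField I W)
    (hVW : ∀ s t : ℝ, ∀ x, expField I (s • V) (expField I (t • W) x) =
      expField I (t • W) (expField I (s • V) x)) (p : M) : mlieBracket I V W p = 0 := by
  have : CompleteSpace E := FiniteDimensional.complete ℝ E
  have : IsManifold I 1 M := IsManifold.of_le (m := 1) (n := ∞) (by simp)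
  let F : ℝ × ℝ → M := fun v ↦ expField I (v.1 • V) (expField I (v.2 • W) p)
  have hF0 : F (0, 0) = p := by simp only [F, hV.expField_zero_smul, hW.expField_zero_smul]
  have hF : ContinuousAt F (0, 0) := by
    intro N hN
    rw [hF0] at hN
    obtain ⟨U, hU, ε, hε, h⟩ := hV.exists_forall_expField_mem hN
    have hc : ContinuousAt (fun t : ℝ ↦ expField I (t • W) p) 0 :=
      (hW.isMIntegralCurve_expField p).continuous.continuousAt
    have hcU := hc.preimage_mem_nhds (by rwa [hW.expField_zero_smul])
    refine mem_map.2 (mem_of_superset (prod_mem_nhds (Ioo_mem_nhds (neg_lt_zero.2 hε) hε) hcU) ?_)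
    exact fun v hv ↦ h _ hv.2 _ hv.1
  have hsrc : ∀ᶠ v in 𝓝 ((0 : ℝ), (0 : ℝ)), F v ∈ (extChartAt I p).source :=
    hF.preimage_mem_nhds (by rw [hF0]; exact extChartAt_source_mem_nhds p)
  have key := lieBracket_eq_zero_of_hasDerivAt_of_hasDerivAt
    (f := chartField I p V) (g := chartField I p W) (F := fun s t ↦ extChartAt I p (F (s, t)))
    (by rw [hF0]; exact (contDiffAt_chartField hV p).of_le (by norm_num))
    (by rw [hF0]; exact (contDiffAt_chartField hW p).of_le (by norm_num))
    (ContinuousAt.comp (g := extChartAt I p) (f := F)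
      (by rw [hF0]; exact continuousAt_extChartAt p) hF)
    (hsrc.mono fun v hv ↦ HasMFDerivAt.hasDerivAt_extChartAt_comp
      (hV.isMIntegralCurve_expField _ v.1) hv)
    -- Only here is commutation used: it puts the `W`-flow outermost, so that the curve in `t` is an
    -- integral curve of `W`.
    (hsrc.mono fun v hv ↦ by
      simp only [F, hVW] at hv ⊢
      exact HasMFDerivAt.hasDerivAt_extChartAt_comp (hW.isMIntegralCurve_expField _ v.2) hv)
  -- The preferred chart at `p` has identity derivative at `p`, so the bracket in the chart is the
  -- bracket itself.
  rw [hF0, ← chartField_mlieBracket hV hW (extChartAt_target_mem_nhds_self p),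
    chartField_extChartAt (mem_extChartAt_source p), mfderiv_extChartAt_self] at key
  exact key

end CovariateDeformation

end Flow

theorem lemma1 {E : Type*} [NormedAddCommGroup E] [NormedSpace ℝ E] [FiniteDimensional ℝ E]
    {H : Type*} [TopologicalSpace H] (I : ModelWithCorners ℝ E H)
    {W : Type*} [TopologicalSpace W] [ChartedSpace H W] [IsManifold I ∞ W]
    [BoundarylessManifold I W] [T2Space W] [CompactSpace W]
    {p : ℕ} (V : Fin p → (w : W) → TangentSpace I w)
    (hV : ∀ m, CovariateDeformation.IsVelocityField I (V m)) :
    CovariateDeformation.PathIndependent I V ↔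
      ∀ m n : Fin p, m ≠ n → ∀ w : W, VectorField.mlieBracket I (V m) (V n) w = 0 := by
  have : CompleteSpace E := FiniteDimensional.complete ℝ E
  have : IsManifold I 2 W := IsManifold.of_le (m := 2) (n := ∞) (by norm_cast)
  constructor
  · intro h m n hmn
    exact (hV m).mlieBracket_eq_zero (hV n) fun s t x ↦ congrFun (h m n hmn s t) x
  · intro h m n hmn s t
    funext x
    -- The time-one result applies to the rescaled fields, since their bracket is a multiple of `[V
    -- m, V n]`.
    refine ((hV m).smul s).expField_comm ((hV n).smul t) (fun y ↦ ?_) x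
    rw [VectorField.mlieBracket_const_smul_left
        ((hV m).contMDiff_one.mdifferentiable one_ne_zero y),
      VectorField.mlieBracket_const_smul_right
        ((hV n).contMDiff_one.mdifferentiable one_ne_zero y), h m n hmn y, smul_zero, smul_zero]
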